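/- Composites are written in diagrammatic order. Let $\mathcal A$ be a category with a zero object and cokernels which is regular (finite limits, coequalizers of kernel pairs, pullback-stable regular epimorphisms) and protomodular (all change-of-base functors between categories of points reflect isomorphisms). A sequentiable family $h_\bullet=\{h_n,i_n\}_{n\in\mathbb Z}$ consists of arrows $h_n\colon \mathrm{Dom}(h_n)\to \mathrm{Cod}(h_n)$ and $i_n\colon \mathrm{Cok}(h_{n+1})\to \mathrm{Ker}(h_n)$. It is isosequentiable if every $i_n$ is an isomorphism. A morphism $f_\bullet\colon h_\bullet\to h'_\bullet$ is a family of arrows $\overline f_n\colon\mathrm{Dom}(h_n)\to\mathrm{Dom}(h'_n)$, $\underline f_n\colon\mathrm{Cod}(h_n)\to\mathrm{Cod}(h'_n)$ such that $\overline f_n h'_n=h_n\underline f_n$ and the induced arrows $K(f)_n\colon\mathrm{Ker}(h_n)\to\mathrm{Ker}(h'_n)$, $C(f)_n\colon\mathrm{Cok}(h_n)\to\mathrm{Cok}(h'_n)$ satisfy $C(f)_{n+1}i'_n=i_nK(f)_n$. This gives a category $\mathrm{Seq}(\mathcal A)$. A nullhomotopy on $f_\bullet$ is a family $\lambda_n\colon\mathrm{Cod}(h_n)\to\mathrm{Dom}(h'_n)$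 with $h_n\lambda_n=\overline f_n$ and $\lambda_nh'_n=\underline f_n$; nullhomotopies are whiskered with morphisms on both sides level-wise. The homotopy kernel $(\mathcal N(f_\bullet),n_f,\nu_f)$ of $f_\bullet$ is the universal triple consisting of an object, an arrow $n_f$ to $h_\bullet$ and a nullhomotopy $\nu_f$ on $n_f f_\bullet$; homotopy cokernels are defined dually. Explicitly, $\mathcal N(f_\bullet)=\{h_n^P,i_n^P\}$, where $P_n$ is the pullback of $\underline f_n$ and $h'_n$, with projections $\pi_n\colon P_n\to\mathrm{Cod}(h_n)$ and $\pi'_n\colon P_n\to \mathrm{Dom}(h'_n)$, and $h^P_n=\langle h_n,\overline f_n\rangle\colon\mathrm{Dom}(h_n)\to P_n$. The arrow $n_f$ is $\{\mathrm{id},\pi_n\}$, inducing $K(\pi)_n\colon\mathrm{Ker}(h^P_n)\to\mathrm{Ker}(h_n)$ and $C(\pi)_n\colon\mathrm{Cok}(h^P_n)\to\mathrm{Cok}(h_n)$; $i^P_n$ is the unique arrow with $i_n^PK(\pi)_n=C(\pi)_{n+1}i_n$; and $\nu_f=\{\pi'_n\}$. Let $q^P_n\colon P_n\to\mathrm{Cok}(h^P_n)$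 and $k'_n\colon\mathrm{Ker}(h'_n)\to\mathrm{Dom}(h'_n)$ be the canonical arrows. For an object $Y$ of $\mathrm{Seq}(\mathcal A)$, let $0_Y\colon 0\to Y$ and $0^Y\colon Y\to 0$ be the initial and terminal arrows, let $c_{0^Y}\colon 0\to\mathcal C(0^Y)$ be the homotopy cokernel of $0^Y$, with nullhomotopy $\gamma_{0^Y}$, let $\pi_0(Y)=\mathcal N(c_{0^Y})$, and let $\eta_Y\colon Y\to\pi_0(Y)$ be the factorization of $(0^Y,\gamma_{0^Y})$ through $\pi_0(Y)$. The constructions $\mathcal N(0_{(-)})$ and $\pi_0$ are functorial by the universal properties. For $g\colon X\to Y$, let $\Delta\colon\mathcal N(0_Y)\to\mathcal N(g)$ be the unique arrow with $\Delta n_g=0$ and $\Delta\circ\nu_g=\nu_{0_Y}$, and let $\delta=\Delta\,\eta_{\mathcal N(g)}$. Let $S$ be the class of regular epimorphisms of $\mathcal A$, and call a morphism $f_\bullet$ of $\mathrm{Seq}(\mathcal A)$ an $S$-morphism if all $\overline f_n,\underline f_n$ are in $S$. A pair $a\colon W\to X$, $b\colon X\to Y$ with a nullhomotopy $\varphi$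 on $ab$ is $S$-exact if the factorization of $(a,\varphi)$ through $\mathcal N(b)$ is in $S$ (when $Y$ is one of the objects of the six-term sequence below, $ab$ has a nullhomotopy only if $ab=0$, and then exactly one). In $\mathcal A$, a pair $a,b$ is $S$-exact if $ab=0$ and the factorization of $a$ through $\mathrm{Ker}(b)$ is in $S$. An object $Y$ of $\mathrm{Seq}(\mathcal A)$ is $S$-proper if the canonical factorization $\mathcal N(\mathrm{id}_Y)\to\mathcal N(\eta_Y)$ of $n_{\mathrm{id}_Y}$ is in $S$. Let $f_\bullet\colon h_\bullet\to h'_\bullet$ be a morphism in $\mathrm{Seq}(\mathcal A)$ such that $\mathcal N(f_\bullet)$, $h_\bullet$ and $h'_\bullet$ are $S$-proper. 1. The six-term sequence in $\mathrm{Seq}(\mathcal A)$ $$\mathcal N(0_{\mathcal N(f_\bullet)})\to\mathcal N(0_{h_\bullet})\to\mathcal N(0_{h'_\bullet})\xrightarrow{\ \delta\ }\pi_0(\mathcal N(f_\bullet))\to\pi_0(h_\bullet)\to\pi_0(h'_\bullet)$$ is $S$-exact at its four inner objects, and so is, for every $n\in\mathbb Z$, the row in $\mathcal A$ $$\mathrm{Ker}(h^P_n)\xrightarrow{K(\pi)_n}\mathrm{Ker}(h_n)\xrightarrow{K(f)_n}\mathrm{Ker}(h'_n)\xrightarrow{\langle0,k'_n\rangle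 q^P_n}\mathrm{Cok}(h^P_n)\xrightarrow{C(\pi)_n}\mathrm{Cok}(h_n)\xrightarrow{C(f)_n}\mathrm{Cok}(h'_n).$$ 2. If moreover $h_\bullet$ and $h'_\bullet$ are isosequentiable, then the long sequence in $\mathcal A$ $$\cdots\to\mathrm{Cok}(h^P_{n+1})\xrightarrow{C(\pi)_{n+1}}\mathrm{Cok}(h_{n+1})\xrightarrow{C(f)_{n+1}i'_n=i_nK(f)_n}\mathrm{Ker}(h'_n)\xrightarrow{\langle0,k'_n\rangle q^P_n}\mathrm{Cok}(h^P_n)\xrightarrow{C(\pi)_n}\mathrm{Cok}(h_n)\to\cdots$$ is $S$-exact at every object. -/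

import Mathlib

open CategoryTheory CategoryTheory.Limits

universe v u w v₁ u₁

namespace Snail

/-! ### Protomodular categories -/

/-- A category with pullbacks is protomodular if, for every arrow `t : X ⟶ Y`, the change-of-base
functor `Pt(Y) ⥤ Pt(X)` between the categories of points (split epimorphisms with a chosen section)
reflects isomorphisms: if `k : (p, s) ⟶ (p', s')` is a morphism of points over `Y` whose pullback
along `t` is invertible, then `k` is invertible. -/
class Protomodular (C : Type u) [Category.{v} C] [HasPullbacks C] : Prop where
  isIso_of_isIso_pullback : ∀ {X Y E E' : C} (t : X ⟶ Y)
    (p : E ⟶ Y) (s : Y ⟶ E) (_ : s ≫ p = 𝟙 Y)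
    (p' : E' ⟶ Y) (s' : Y ⟶ E') (_ : s' ≫ p' = 𝟙 Y)
    (k : E ⟶ E') (hk : k ≫ p' = p) (_ : s ≫ k = s'),
    IsIso (pullback.map p t p' t k (𝟙 X) (𝟙 Y) (by simp [hk]) (by simp)) → IsIso k

/-! ### Structures of nullhomotopies -/

/-- A structure of nullhomotopies on a category: a set `Null g` for every arrow `g`, and whiskering
operations `φ ↦ f ∘ φ ∘ h` from `Null g` to `Null (f ≫ g ≫ h)`, functorial in `f` and `h`.
The whiskering takes as argument a proof that `f ≫ g ≫ h` equals a given arrow `g'`, so that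
equal composites need not be syntactically equal. -/
structure NullStructure (B : Type u) [Category.{v} B] where
  Null : ∀ {X Y : B}, (X ⟶ Y) → Type w
  whisker : ∀ {W X Y Z : B} (f : W ⟶ X) {g : X ⟶ Y} (h : Y ⟶ Z) {g' : W ⟶ Z},
    f ≫ g ≫ h = g' → Null g → Null g'
  whisker_id : ∀ {X Y : B} {g : X ⟶ Y} (e : 𝟙 X ≫ g ≫ 𝟙 Y = g) (φ : Null g),
    whisker (𝟙 X) (𝟙 Y) e φ = φ
  whisker_comp : ∀ {V W X Y Z T : B} (f' : V ⟶ W) (f : W ⟶ X) {g : X ⟶ Y} (h : Y ⟶ Z)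
    (h' : Z ⟶ T) {g' : W ⟶ Z} {g'' : V ⟶ T} (e : f ≫ g ≫ h = g') (e' : f' ≫ g' ≫ h' = g'')
    (e'' : (f' ≫ f) ≫ g ≫ (h ≫ h') = g'') (φ : Null g),
    whisker (f' ≫ f) (h ≫ h') e'' φ = whisker f' h' e' (whisker f h e φ)

namespace NullStructure

variable {B : Type u} [Category.{v} B] (Θ : NullStructure.{v, u, w} B)

/-- `f ∘ φ`, as a nullhomotopy on any arrow equal to `f ≫ g`. -/
def pre {W X Y : B} (f : W ⟶ X) {g : X ⟶ Y} {g' : W ⟶ Y} (e : f ≫ g = g') (φ : Θ.Null g) :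
    Θ.Null g' :=
  Θ.whisker f (𝟙 Y) (by simpa using e) φ

/-- `φ ∘ h`, as a nullhomotopy on any arrow equal to `g ≫ h`. -/
def post {X Y Z : B} {g : X ⟶ Y} (h : Y ⟶ Z) {g' : X ⟶ Z} (e : g ≫ h = g') (φ : Θ.Null g) :
    Θ.Null g' :=
  Θ.whisker (𝟙 X) h (by simpa using e) φ

/-- A homotopy kernel of `g`: a universal triple `(N(g), n_g, ν_g)`. -/
structure HKernel {X Y : B} (g : X ⟶ Y) where
  obj : B
  ι : obj ⟶ X
  ν : Θ.Null (ι ≫ g)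
  lift : ∀ {W : B} (f : W ⟶ X), Θ.Null (f ≫ g) → (W ⟶ obj)
  lift_ι : ∀ {W : B} (f : W ⟶ X) (φ : Θ.Null (f ≫ g)), lift f φ ≫ ι = f
  lift_ν : ∀ {W : B} (f : W ⟶ X) (φ : Θ.Null (f ≫ g)) (e : lift f φ ≫ ι ≫ g = f ≫ g),
    Θ.pre (lift f φ) e ν = φ
  uniq : ∀ {W : B} (f : W ⟶ X) (φ : Θ.Null (f ≫ g)) (k : W ⟶ obj) (_ : k ≫ ι = f)
    (e : k ≫ ι ≫ g = f ≫ g), Θ.pre k e ν = φ → k = lift f φ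

/-- A homotopy cokernel of `g`: a universal triple `(C(g), c_g, γ_g)`. -/
structure HCokernel {X Y : B} (g : X ⟶ Y) where
  obj : B
  π : Y ⟶ obj
  γ : Θ.Null (g ≫ π)
  desc : ∀ {Z : B} (f : Y ⟶ Z), Θ.Null (g ≫ f) → (obj ⟶ Z)
  π_desc : ∀ {Z : B} (f : Y ⟶ Z) (φ : Θ.Null (g ≫ f)), π ≫ desc f φ = f
  γ_desc : ∀ {Z : B} (f : Y ⟶ Z) (φ : Θ.Null (g ≫ f)) (e : (g ≫ π) ≫ desc f φ = g ≫ f),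
    Θ.post (desc f φ) e γ = φ
  uniq : ∀ {Z : B} (f : Y ⟶ Z) (φ : Θ.Null (g ≫ f)) (k : obj ⟶ Z) (_ : π ≫ k = f)
    (e : (g ≫ π) ≫ k = g ≫ f), Θ.post k e γ = φ → k = desc f φ

/-- A choice of a zero object, of homotopy kernels of all arrows and of homotopy cokernels of all
terminal arrows. -/
structure Setting where
  zero : B
  isZero : IsZero zero
  hker : ∀ {X Y : B} (g : X ⟶ Y), Θ.HKernel g
  hcok : ∀ X : B, Θ.HCokernel (isZero.from_ X)

namespace Setting

variable {Θ} (D : Θ.Setting)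

/-- The object `N(g)`. -/
noncomputable abbrev N {X Y : B} (g : X ⟶ Y) : B := (D.hker g).obj

/-- The arrow `n_g : N(g) ⟶ X`. -/
noncomputable abbrev n {X Y : B} (g : X ⟶ Y) : D.N g ⟶ X := (D.hker g).ι

/-- The nullhomotopy `ν_g` on `n_g ≫ g`. -/
noncomputable abbrev ν {X Y : B} (g : X ⟶ Y) : Θ.Null (D.n g ≫ g) := (D.hker g).ν

/-- The object `N(0_Y)`, where `0_Y` is the initial arrow of `Y`. -/
noncomputable abbrev N₀ (Y : B) : B := D.N (D.isZero.to_ Y)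

/-- The object `C(0^Y)`, where `0^Y` is the terminal arrow of `Y`. -/
noncomputable abbrev C₀ (Y : B) : B := (D.hcok Y).obj

/-- The arrow `c_{0^Y} : 0 ⟶ C(0^Y)`. -/
noncomputable abbrev c₀ (Y : B) : D.zero ⟶ D.C₀ Y := (D.hcok Y).π

/-- The nullhomotopy `γ_{0^Y}`. -/
noncomputable abbrev γ₀ (Y : B) : Θ.Null (D.isZero.from_ Y ≫ D.c₀ Y) := (D.hcok Y).γ

/-- The object `π₀(Y)`, the homotopy kernel of `c_{0^Y}`. -/
noncomputable abbrev pi0 (Y : B) : B := D.N (D.c₀ Y)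

/-- `η_Y : Y ⟶ π₀(Y)`, the unique arrow with `η_Y ∘ ν_{c_{0^Y}} = γ_{0^Y}`. -/
noncomputable def η (Y : B) : Y ⟶ D.pi0 Y := (D.hker (D.c₀ Y)).lift (D.isZero.from_ Y) (D.γ₀ Y)

/-- `n(g) : N(0_X) ⟶ N(0_Y)`, the unique arrow with `n(g) ∘ ν_{0_Y} = ν_{0_X} ∘ g`. -/
noncomputable def mapN₀ {X Y : B} (g : X ⟶ Y) : D.N₀ X ⟶ D.N₀ Y :=
  (D.hker (D.isZero.to_ Y)).lift (D.n (D.isZero.to_ X))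
    (Θ.post g (by rw [Category.assoc]; congr 1; exact D.isZero.eq_of_src _ _)
      (D.ν (D.isZero.to_ X)))

/-- `c(g) : C(0^X) ⟶ C(0^Y)`, the unique arrow with `γ_{0^X} ∘ c(g) = g ∘ γ_{0^Y}`. -/
noncomputable def mapC₀ {X Y : B} (g : X ⟶ Y) : D.C₀ X ⟶ D.C₀ Y :=
  (D.hcok X).desc (D.c₀ Y)
    (Θ.pre g (by rw [← Category.assoc]; congr 1; exact D.isZero.eq_of_tgt _ _) (D.γ₀ Y))

/-- `π₀(g) : π₀(X) ⟶ π₀(Y)`, the unique arrow with `π₀(g) ∘ ν_{c_{0^Y}} = ν_{c_{0^X}} ∘ c(g)`. -/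
noncomputable def mapPi0 {X Y : B} (g : X ⟶ Y) : D.pi0 X ⟶ D.pi0 Y :=
  (D.hker (D.c₀ Y)).lift (D.n (D.c₀ X))
    (Θ.post (D.mapC₀ g) (by rw [Category.assoc]; congr 1; exact D.isZero.eq_of_src _ _)
      (D.ν (D.c₀ X)))

/-- `Δ : N(0_Y) ⟶ N(g)`, the unique arrow with `Δ ≫ n_g = 0` and `Δ ∘ ν_g = ν_{0_Y}`. -/
noncomputable def Δ {X Y : B} (g : X ⟶ Y) : D.N₀ Y ⟶ D.N g :=
  (D.hker g).lift (D.isZero.from_ (D.N₀ Y) ≫ D.isZero.to_ X)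
    (Θ.pre (𝟙 _)
      (by
        rw [Category.id_comp, Category.assoc, D.isZero.eq_of_tgt (D.n (D.isZero.to_ Y))
          (D.isZero.from_ (D.N₀ Y))]
        congr 1
        exact D.isZero.eq_of_src _ _)
      (D.ν (D.isZero.to_ Y)))

/-- The connecting arrow `δ : N(0_Y) ⟶ π₀(N(g))` of the snail sequence. -/
noncomputable def δ {X Y : B} (g : X ⟶ Y) : D.N₀ Y ⟶ D.pi0 (D.N g) := D.Δ g ≫ D.η (D.N g)

/-- `(f, φ, g)` is `S`-exact: the factorization of `(f, φ)` through the homotopy kernel of `g`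
is in `S`. -/
def IsExact (S : MorphismProperty B) {W X Y : B} (f : W ⟶ X) (g : X ⟶ Y) (φ : Θ.Null (f ≫ g)) :
    Prop :=
  S ((D.hker g).lift f φ)

/-- `S`-exactness of the six-term snail sequence
`N(0_{N(g)}) ⟶ N(0_X) ⟶ N(0_Y) ⟶ π₀(N(g)) ⟶ π₀(X) ⟶ π₀(Y)` of `g : X ⟶ Y` at its four inner
objects. These objects are discrete: an arrow into one of them carries a nullhomotopy
only if it is zero, and then exactly one. -/
def IsSnailExact (S : MorphismProperty B) {X Y : B} (g : X ⟶ Y) : Prop :=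
  (∃ φ, D.IsExact S (D.mapN₀ (D.n g)) (D.mapN₀ g) φ) ∧
  (∃ φ, D.IsExact S (D.mapN₀ g) (D.δ g) φ) ∧
  (∃ φ, D.IsExact S (D.δ g) (D.mapPi0 (D.n g)) φ) ∧
  (∃ φ, D.IsExact S (D.mapPi0 (D.n g)) (D.mapPi0 g) φ)

/-- The arrow `N(id_Y) ⟶ N(η_Y)` over `Y` which is compatible with the nullhomotopies. -/
noncomputable def properArrow (Y : B) : D.N (𝟙 Y) ⟶ D.N (D.η Y) :=
  (D.hker (D.η Y)).lift (D.n (𝟙 Y))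
    (Θ.post (D.η Y) (by rw [Category.assoc, Category.id_comp]) (D.ν (𝟙 Y)))

/-- `Y` is `S`-proper. -/
def IsProper (S : MorphismProperty B) (Y : B) : Prop := S (D.properArrow Y)

end Setting

end NullStructure

/-! ### Sequentiable families -/

section

variable (A : Type u) [Category.{v} A] [HasZeroMorphisms A] [HasKernels A] [HasCokernels A]

/-- A sequentiable family of arrows `{h_n, i_n}`, indexed by the integers, with
`i_n : Cok(h_{n+1}) ⟶ Ker(h_n)`. -/
structure SeqFam where
  dom : ℤ → A
  cod : ℤ → A
  h : ∀ n, dom n ⟶ cod n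
  i : ∀ n, cokernel (h (n + 1)) ⟶ kernel (h n)

end

section

variable {A : Type u} [Category.{v} A] [HasZeroMorphisms A] [HasKernels A] [HasCokernels A]

namespace SeqFam

/-- A morphism of sequentiable families. -/
@[ext]
structure Hom (X Y : SeqFam A) where
  top : ∀ n, X.dom n ⟶ Y.dom n
  bot : ∀ n, X.cod n ⟶ Y.cod n
  comm : ∀ n, top n ≫ Y.h n = X.h n ≫ bot n
  conn : ∀ n, bot (n + 1) ≫ cokernel.π (Y.h (n + 1)) ≫ Y.i n ≫ kernel.ι (Y.h n) =
    cokernel.π (X.h (n + 1)) ≫ X.i n ≫ kernel.ι (X.h n) ≫ top n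

instance : Category (SeqFam A) where
  Hom := Hom
  id X :=
    { top := fun n => 𝟙 (X.dom n)
      bot := fun n => 𝟙 (X.cod n)
      comm := fun n => by simp
      conn := fun n => by simp }
  comp f g :=
    { top := fun n => f.top n ≫ g.top n
      bot := fun n => f.bot n ≫ g.bot n
      comm := fun n => by rw [Category.assoc, g.comm, reassoc_of% (f.comm n)]
      conn := fun n => by
        rw [Category.assoc, g.conn, reassoc_of% (f.conn n)] }
  id_comp f := by apply Hom.ext <;> simp
  comp_id f := by apply Hom.ext <;> simp
  assoc f g k := by apply Hom.ext <;> simp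

@[ext]
theorem hom_ext {X Y : SeqFam A} {f g : X ⟶ Y} (h₁ : ∀ n, f.top n = g.top n)
    (h₂ : ∀ n, f.bot n = g.bot n) : f = g :=
  Hom.ext (funext h₁) (funext h₂)

@[simp] theorem id_top (X : SeqFam A) (n : ℤ) : Hom.top (𝟙 X) n = 𝟙 (X.dom n) := rfl
@[simp] theorem id_bot (X : SeqFam A) (n : ℤ) : Hom.bot (𝟙 X) n = 𝟙 (X.cod n) := rfl
@[simp] theorem comp_top {X Y Z : SeqFam A} (f : X ⟶ Y) (g : Y ⟶ Z) (n : ℤ) :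
    (f ≫ g).top n = f.top n ≫ g.top n := rfl
@[simp] theorem comp_bot {X Y Z : SeqFam A} (f : X ⟶ Y) (g : Y ⟶ Z) (n : ℤ) :
    (f ≫ g).bot n = f.bot n ≫ g.bot n := rfl

/-- `K(f)_n : Ker(h_n) ⟶ Ker(h'_n)`. -/
noncomputable def Kmap {X Y : SeqFam A} (f : X ⟶ Y) (n : ℤ) : kernel (X.h n) ⟶ kernel (Y.h n) :=
  kernel.map _ _ (f.top n) (f.bot n) (f.comm n).symm

/-- `C(f)_n : Cok(h_n) ⟶ Cok(h'_n)`. -/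
noncomputable def Cmap {X Y : SeqFam A} (f : X ⟶ Y) (n : ℤ) :
    cokernel (X.h n) ⟶ cokernel (Y.h n) :=
  cokernel.map _ _ (f.top n) (f.bot n) (f.comm n).symm

theorem Cmap_i {X Y : SeqFam A} (f : X ⟶ Y) (n : ℤ) :
    Cmap f (n + 1) ≫ Y.i n = X.i n ≫ Kmap f n := by
  rw [← cancel_epi (cokernel.π (X.h (n + 1))), ← cancel_mono (kernel.ι (Y.h n))]
  simpa [Cmap, Kmap] using f.conn n

/-- The arrow `C(f)_{n+1} ≫ i'_n = i_n ≫ K(f)_n` from `Cok(h_{n+1})` to `Ker(h'_n)`. -/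
noncomputable def link {X Y : SeqFam A} (f : X ⟶ Y) (n : ℤ) :
    cokernel (X.h (n + 1)) ⟶ kernel (Y.h n) :=
  Cmap f (n + 1) ≫ Y.i n

/-- The family is isosequentiable: all connecting arrows are invertible. -/
def IsIsoSeq (X : SeqFam A) : Prop := ∀ n, IsIso (X.i n)

/-- The extension to sequentiable families of a class of arrows `S`. -/
def levelwise (S : MorphismProperty A) : MorphismProperty (SeqFam A) :=
  fun _ _ f => ∀ n, S (Hom.top f n) ∧ S (Hom.bot f n)

/-! ### Nullhomotopies of morphisms of sequentiable families -/

/-- A nullhomotopy: a family of diagonals `Cod(h_n) ⟶ Dom(h'_n)`. -/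
@[ext]
structure Null {X Y : SeqFam A} (f : X ⟶ Y) where
  diag : ∀ n, X.cod n ⟶ Y.dom n
  h_diag : ∀ n, X.h n ≫ diag n = f.top n
  diag_h : ∀ n, diag n ≫ Y.h n = f.bot n

variable (A) in
/-- The structure of nullhomotopies given by the diagonals. -/
abbrev nullStructure : NullStructure (SeqFam A) where
  Null f := Null f
  whisker {_ _ _ _} f {g} h {g'} e φ :=
    { diag := fun n => f.bot n ≫ φ.diag n ≫ h.top n
      h_diag := fun n => by
        subst e
        rw [← reassoc_of% (f.comm n), reassoc_of% (φ.h_diag n)]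
        rfl
      diag_h := fun n => by
        subst e
        rw [Category.assoc, Category.assoc, h.comm, reassoc_of% (φ.diag_h n)]
        rfl }
  whisker_id e φ := by apply Null.ext; funext n; simp
  whisker_comp f' f g h h' _ _ e e' e'' φ := by apply Null.ext; funext n; simp

@[simp] theorem pre_diag {W X Y : SeqFam A} (f : W ⟶ X) {g : X ⟶ Y} {g' : W ⟶ Y}
    (e : f ≫ g = g') (φ : (nullStructure A).Null g) (n : ℤ) :
    Null.diag ((nullStructure A).pre f e φ) n = f.bot n ≫ Null.diag φ n := by
  change f.bot n ≫ Null.diag φ n ≫ 𝟙 _ = _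
  rw [Category.comp_id]

@[simp] theorem post_diag {X Y Z : SeqFam A} {g : X ⟶ Y} (h : Y ⟶ Z) {g' : X ⟶ Z}
    (e : g ≫ h = g') (φ : (nullStructure A).Null g) (n : ℤ) :
    Null.diag ((nullStructure A).post h e φ) n = Null.diag φ n ≫ h.top n := by
  change 𝟙 _ ≫ Null.diag φ n ≫ h.top n = _
  rw [Category.id_comp]

/-! ### The homotopy kernel of a morphism -/

section HKer

variable [HasPullbacks A] {X Y : SeqFam A} (f : X ⟶ Y)

/-- `h^P_n : Dom(h_n) ⟶ P_n`, where `P_n` is the pullback of `Cod(h_n) ⟶ Cod(h'_n)` along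
`h'_n`. -/
noncomputable def hP (n : ℤ) : X.dom n ⟶ pullback (f.bot n) (Y.h n) :=
  pullback.lift (X.h n) (f.top n) (f.comm n).symm

theorem hP_fst (n : ℤ) : hP f n ≫ pullback.fst (f.bot n) (Y.h n) = X.h n :=
  pullback.lift_fst _ _ _

theorem hP_snd (n : ℤ) : hP f n ≫ pullback.snd (f.bot n) (Y.h n) = f.top n :=
  pullback.lift_snd _ _ _

/-- The arrow `Cok(h^P_n) ⟶ Cok(h_n)` induced by the projection `P_n ⟶ Cod(h_n)`. -/
noncomputable def Cproj (n : ℤ) : cokernel (hP f n) ⟶ cokernel (X.h n) :=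
  cokernel.map _ _ (𝟙 _) (pullback.fst _ _) (by rw [hP_fst, Category.id_comp])

theorem π_Cproj (n : ℤ) : cokernel.π (hP f n) ≫ Cproj f n =
    pullback.fst (f.bot n) (Y.h n) ≫ cokernel.π (X.h n) :=
  cokernel.π_desc _ _ _

theorem Cproj_hP (n : ℤ) :
    (Cproj f (n + 1) ≫ X.i n ≫ kernel.ι (X.h n)) ≫ hP f n = 0 := by
  apply pullback.hom_ext
  · rw [Category.assoc, hP_fst, Category.assoc, Category.assoc, kernel.condition, comp_zero,
      comp_zero, zero_comp]
  · rw [← cancel_epi (cokernel.π (hP f (n + 1))), Category.assoc, hP_snd, Category.assoc,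
      Category.assoc, reassoc_of% (π_Cproj f (n + 1)), ← f.conn n, pullback.condition_assoc,
      cokernel.condition_assoc, zero_comp, comp_zero, zero_comp, comp_zero]

/-- The sequentiable family `N(f) = {h^P_n, i^P_n}`. -/
noncomputable abbrev hkerObj : SeqFam A where
  dom := X.dom
  cod n := pullback (f.bot n) (Y.h n)
  h := hP f
  i n := kernel.lift _ (Cproj f (n + 1) ≫ X.i n ≫ kernel.ι (X.h n)) (Cproj_hP f n)

theorem hkerObj_conn (n : ℤ) :
    cokernel.π (hP f (n + 1)) ≫ (hkerObj f).i n ≫ kernel.ι (hP f n) =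
      pullback.fst (f.bot (n + 1)) (Y.h (n + 1)) ≫ cokernel.π (X.h (n + 1)) ≫ X.i n ≫
        kernel.ι (X.h n) := by
  rw [kernel.lift_ι, reassoc_of% (π_Cproj f (n + 1))]

/-- The morphism `n_f : N(f) ⟶ h`, given by identities and by the projections
`π_n : P_n ⟶ Cod(h_n)`. -/
noncomputable def hkerι : hkerObj f ⟶ X where
  top n := 𝟙 (X.dom n)
  bot n := pullback.fst _ _
  comm n := (Category.id_comp _).trans (hP_fst f n).symm
  conn n := by
    rw [Category.comp_id]
    exact (hkerObj_conn f n).symm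

/-- The homotopy kernel of `f`, with nullhomotopy given by the projections
`P_n ⟶ Dom(h'_n)`. -/
noncomputable def hker : (nullStructure A).HKernel f where
  obj := hkerObj f
  ι := hkerι f
  ν :=
    { diag := fun n => pullback.snd (f.bot n) (Y.h n)
      h_diag := fun n => (hP_snd f n).trans (Category.id_comp _).symm
      diag_h := fun n => pullback.condition.symm }
  lift g φ :=
    { top := g.top
      bot := fun n => pullback.lift (g.bot n) (Null.diag φ n) (Null.diag_h φ n).symm
      comm := fun n => by
        apply pullback.hom_ext
        · rw [Category.assoc, Category.assoc, hP_fst, pullback.lift_fst, g.comm]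
        · rw [Category.assoc, Category.assoc, hP_snd, pullback.lift_snd, Null.h_diag φ n, comp_top]
      conn := fun n => by
        rw [hkerObj_conn, pullback.lift_fst_assoc, g.conn] }
  lift_ι g φ := by
    apply hom_ext
    · intro n; exact Category.comp_id _
    · intro n; exact pullback.lift_fst _ _ _
  lift_ν g φ e := by
    apply Null.ext
    funext n
    rw [pre_diag]
    exact pullback.lift_snd _ _ _
  uniq g φ k hk e hφ := by
    subst hk
    apply hom_ext
    · intro n; exact (Category.comp_id _).symm
    · intro n
      apply pullback.hom_ext
      · exact (pullback.lift_fst _ _ _).symm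
      · refine Eq.trans ?_ (pullback.lift_snd _ _ _).symm
        rw [← hφ, pre_diag]

end HKer

/-! ### The zero family and the homotopy cokernels of terminal arrows -/

section Zero

variable [HasZeroObject A]

open ZeroObject

variable (A) in
/-- The zero sequentiable family. -/
noncomputable abbrev zeroFam : SeqFam A where
  dom _ := 0
  cod _ := 0
  h _ := 𝟙 0
  i _ := 0

theorem zeroFam_dom (n : ℤ) : IsZero ((zeroFam A).dom n) := isZero_zero A

theorem zeroFam_cod (n : ℤ) : IsZero ((zeroFam A).cod n) := isZero_zero A

variable (A) in
theorem isZero_zeroFam : IsZero (zeroFam A) where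
  unique_to Y :=
    ⟨{ default :=
        { top := fun n => 0
          bot := fun n => 0
          comm := fun n => by simp
          conn := fun n => by simp }
       uniq := fun f => hom_ext (fun n => (zeroFam_dom n).eq_of_src _ _)
        (fun n => (zeroFam_cod n).eq_of_src _ _) }⟩
  unique_from Y :=
    ⟨{ default :=
        { top := fun n => 0
          bot := fun n => 0
          comm := fun n => by simp
          conn := fun n => by simp }
       uniq := fun f => hom_ext (fun n => (zeroFam_dom n).eq_of_tgt _ _)
        (fun n => (zeroFam_cod n).eq_of_tgt _ _) }⟩

/-- The sequentiable family with `n`-th arrow `Cok(h_n) ⟶ 0`. -/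
noncomputable abbrev hcokObj (X : SeqFam A) : SeqFam A where
  dom n := cokernel (X.h n)
  cod _ := 0
  h _ := 0
  i _ := 0

/-- The homotopy cokernel of the terminal arrow of `X`, with nullhomotopy given by the
projections `Cod(h_n) ⟶ Cok(h_n)`. -/
noncomputable def hcok (X : SeqFam A) :
    (nullStructure A).HCokernel ((isZero_zeroFam A).from_ X) where
  obj := hcokObj X
  π := (isZero_zeroFam A).to_ (hcokObj X)
  γ :=
    { diag := fun n => cokernel.π (X.h n)
      h_diag := fun n => by
        rw [cokernel.condition, comp_top,
          (zeroFam_dom n).eq_of_tgt (Hom.top ((isZero_zeroFam A).from_ X) n) 0, zero_comp]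
      diag_h := fun n => (isZero_zero A).eq_of_tgt _ _ }
  desc {Z} f φ :=
    { top := fun n => cokernel.desc (X.h n) (Null.diag φ n) (by
        rw [Null.h_diag φ n, comp_top,
          (zeroFam_dom n).eq_of_tgt (Hom.top ((isZero_zeroFam A).from_ X) n) 0, zero_comp])
      bot := fun n => 0
      comm := fun n => by
        apply coequalizer.hom_ext
        rw [cokernel.π_desc_assoc, Null.diag_h φ n, comp_bot,
          (zeroFam_cod n).eq_of_tgt (Hom.bot ((isZero_zeroFam A).from_ X) n) 0, zero_comp]
        simp
      conn := fun n => by simp [hcokObj] }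
  π_desc f φ := (isZero_zeroFam A).eq_of_src _ _
  γ_desc f φ e := by
    apply Null.ext
    funext n
    rw [post_diag]
    exact cokernel.π_desc _ _ _
  uniq f φ k hk e hφ := by
    apply hom_ext
    · intro n
      apply coequalizer.hom_ext
      refine Eq.trans ?_ (cokernel.π_desc _ _ _).symm
      rw [← hφ, post_diag]
    · intro n
      exact (isZero_zero A).eq_of_src _ _

variable (A) in
/-- The zero object, the homotopy kernels and the homotopy cokernels of terminal arrows for
sequentiable families. -/
noncomputable def setting [HasPullbacks A] : (nullStructure A).Setting where
  zero := zeroFam A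
  isZero := isZero_zeroFam A
  hker f := hker f
  hcok X := hcok X

end Zero

/-! ### The six-term rows and the long sequence in the base category -/

section Rows

variable [HasPullbacks A] {X Y : SeqFam A} (f : X ⟶ Y)

/-- The arrow `⟨0, k'_n⟩ ≫ q^P_n : Ker(h'_n) ⟶ P_n ⟶ Cok(h^P_n)`. -/
noncomputable def rowδ (n : ℤ) : kernel (Y.h n) ⟶ cokernel ((hkerObj f).h n) :=
  pullback.lift (f := f.bot n) (g := Y.h n) 0 (kernel.ι (Y.h n)) (by simp) ≫
    cokernel.π ((hkerObj f).h n)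

end Rows

end SeqFam

/-- `S`-exactness of `f, g` in a category with zero morphisms and kernels: the composite is zero
and the factorization of `f` through the kernel of `g` is in `S`. -/
def IsExactAt (S : MorphismProperty A) {X Y Z : A} (f : X ⟶ Y) (g : Y ⟶ Z) : Prop :=
  ∃ w : f ≫ g = 0, S (kernel.lift g f w)

namespace SeqFam

variable [HasPullbacks A] {X Y : SeqFam A}

/-- `S`-exactness of the `n`-th six-term row
`Ker(h^P_n) ⟶ Ker(h_n) ⟶ Ker(h'_n) ⟶ Cok(h^P_n) ⟶ Cok(h_n) ⟶ Cok(h'_n)`. -/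
def IsRowExact (S : MorphismProperty A) (f : X ⟶ Y) (n : ℤ) : Prop :=
  IsExactAt S (Kmap (hkerι f) n) (Kmap f n) ∧
  IsExactAt S (Kmap f n) (rowδ f n) ∧
  IsExactAt S (rowδ f n) (Cmap (hkerι f) n) ∧
  IsExactAt S (Cmap (hkerι f) n) (Cmap f n)

/-- `S`-exactness at every object of the long sequence
`… ⟶ Cok(h_{n+1}) ⟶ Ker(h'_n) ⟶ Cok(h^P_n) ⟶ Cok(h_n) ⟶ Ker(h'_{n-1}) ⟶ …`. -/
def IsLongExact (S : MorphismProperty A) (f : X ⟶ Y) : Prop :=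
  ∀ n : ℤ,
    IsExactAt S (link f n) (rowδ f n) ∧
    IsExactAt S (rowδ f n) (Cmap (hkerι f) n) ∧
    IsExactAt S (Cmap (hkerι f) (n + 1)) (link f n)

end SeqFam

end

end Snail

/-! At each level, properness of a family yields that `h_n` covers the kernel of its cokernel by a
regular epimorphism (`IsProper.isRegularEpi_lift`). Regular epimorphisms are pullback-stable, so
exactness of the rows can be chased on generalized elements, up to passing to a cover
(`isExactAt_of_cover`).

Three of the four places are short chases. An element of `Ker(h_n)` killed by `K(f)_n` is killed by
both components of `h^P_n`. If `⟨0, y⟩` dies in `Cok(h^P_n)`, properness of `N(f)` makes it locally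
of the form `h^P_n(x)`; then `x` lies in `Ker(h_n)` and is sent to `y`. A class in `Cok(h_n)` killed
by `C(f)_n` has locally a representative `b` whose image is `h'_n(y)` for some `y`, by properness of
`h'`, and `(b, y)` is an element of `P_n`.

At `Cok(h^P_n)` one would like to subtract some `h^P_n(x)` from an element of `P_n`. Subtraction is
not available; protomodularity replaces it, in the form that a subobject containing the kernel of
`ρ` and still covering the target of `ρ` is everything (`isIso_of_kernel_le`,
`isExactAt_of_kernel_cover`). Properness of `h` enters here.

Both other sequences follow from the rows. The families `N(0_Y)` and `π₀(Y)` are `0 ⟶ Ker(h_n)` and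
`0 ⟶ Cok(h_n)`, and homotopy kernels of arrows between such families are levelwise kernels. The long
sequence splices the rows along the isomorphisms `i_n` and `i'_n`. -/

namespace Snail

/-! ### Regular epimorphisms: composition and cancellation -/

section Regular

variable {A : Type u} [Category.{v} A] [Regular A]

/-- In a regular category the regular epimorphisms are the strong ones, and strong epimorphisms have
this cancellation property. -/
theorem isRegularEpi_of_comp {X Y Z : A} (f : X ⟶ Y) (g : Y ⟶ Z) [IsRegularEpi (f ≫ g)] :
    IsRegularEpi g := by
  have : StrongEpi g := strongEpi_of_strongEpi f g
  infer_instance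

theorem isRegularEpi_comp {X Y Z : A} (f : X ⟶ Y) (g : Y ⟶ Z) [IsRegularEpi f]
    [IsRegularEpi g] : IsRegularEpi (f ≫ g) := by
  have : StrongEpi (f ≫ g) := strongEpi_comp f g
  infer_instance

end Regular

/-! ### Exactness and the protomodular replacement for subtraction -/

section Pointed

variable {A : Type u} [Category.{v} A] [HasZeroMorphisms A] [Regular A]

/-- Exactness can be checked after covering the kernel by a regular epimorphism. -/
theorem isExactAt_of_cover {T X Y Z : A} {f : X ⟶ Y} {g : Y ⟶ Z} (w : f ≫ g = 0)
    (p : T ⟶ X) (r : T ⟶ kernel g) [IsRegularEpi r] (e : p ≫ f = r ≫ kernel.ι g) :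
    IsExactAt (MorphismProperty.regularEpi A) f g := by
  refine ⟨w, ?_⟩
  have h : p ≫ kernel.lift g f w = r := by
    rw [← cancel_mono (kernel.ι g), Category.assoc, kernel.lift_ι, e]
  have : IsRegularEpi (p ≫ kernel.lift g f w) := by rwa [h]
  exact isRegularEpi_of_comp p _

/-- Exactness is invariant under isomorphism. -/
theorem IsExactAt.of_iso {X Y Z X' Y' Z' : A} {f : X ⟶ Y} {g : Y ⟶ Z} {f' : X' ⟶ Y'}
    {g' : Y' ⟶ Z'} (H : IsExactAt (MorphismProperty.regularEpi A) f' g') (x : X ≅ X')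
    (y : Y ≅ Y') (z : Z ≅ Z') (hf : f ≫ y.hom = x.hom ≫ f') (hg : g ≫ z.hom = y.hom ≫ g') :
    IsExactAt (MorphismProperty.regularEpi A) f g := by
  obtain ⟨w, hw⟩ := H
  have hw' : IsRegularEpi (kernel.lift g' f' w) := hw
  have w' : f ≫ g = 0 := by
    rw [← cancel_mono z.hom, Category.assoc, hg, reassoc_of% hf, w, comp_zero, zero_comp]
  have hg' : g' ≫ z.inv = y.inv ≫ g := by
    rw [Iso.comp_inv_eq, Category.assoc, hg, Iso.inv_hom_id_assoc]
  have := isRegularEpi_comp (kernel.lift g' f' w) (kernel.map g' g y.inv z.inv hg')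
  refine isExactAt_of_cover w' x.inv
    (kernel.lift g' f' w ≫ kernel.map g' g y.inv z.inv hg') ?_
  rw [Category.assoc, kernel.lift_ι, kernel.lift_ι_assoc, Iso.inv_comp_eq, ← Category.assoc,
    ← hf, Category.assoc, Iso.hom_inv_id, Category.comp_id]

/-- In a pointed regular protomodular category, a subobject of `R` which contains the kernel of
`ρ : R ⟶ Z` and is mapped onto `Z` by a regular epimorphism is the whole of `R`. -/
theorem isIso_of_kernel_le [HasZeroObject A] [Protomodular A] {R' R Z : A} (j : R' ⟶ R) [Mono j]
    (ρ : R ⟶ Z) [IsRegularEpi (j ≫ ρ)] (l : kernel ρ ⟶ R') (hl : l ≫ j = kernel.ι ρ) :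
    IsIso j := by
  -- Both pullbacks are points over `R'` by the first projection, with sections the diagonal and
  -- `⟨1, j⟩`. The fibres over `0` are `Ker(j ≫ ρ)` and `Ker(ρ)`, which agree because `R'` contains
  -- `Ker(ρ)`; so `k` is invertible.
  let k : pullback (j ≫ ρ) (j ≫ ρ) ⟶ pullback (j ≫ ρ) ρ :=
    pullback.lift (pullback.fst _ _) (pullback.snd _ _ ≫ j)
      (by rw [Category.assoc]; exact pullback.condition)
  have hk₁ : k ≫ pullback.fst _ _ = pullback.fst _ _ := pullback.lift_fst _ _ _
  have hk₂ : k ≫ pullback.snd _ _ = pullback.snd _ _ ≫ j := pullback.lift_snd _ _ _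
  clear_value k
  open ZeroObject in
  have hk : IsIso k := by
    refine Protomodular.isIso_of_isIso_pullback (0 : (0 : A) ⟶ R') (pullback.fst _ _)
      (pullback.lift (𝟙 _) (𝟙 _) rfl) (pullback.lift_fst _ _ _) (pullback.fst _ _)
      (pullback.lift (𝟙 _) j (by simp)) (pullback.lift_fst _ _ _) k hk₁ ?_ ?_
    · apply pullback.hom_ext
      · rw [Category.assoc, hk₁, pullback.lift_fst, pullback.lift_fst]
      · rw [Category.assoc, hk₂, pullback.lift_snd_assoc, pullback.lift_snd, Category.id_comp]
    -- The fibre over `0` consists of pairs `(0, x)` with `x` in `Ker(ρ)`, and `l` lifts `x` to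
    -- `R'`; this gives the inverse on fibres.
    · have h₀ : pullback.fst (pullback.fst (j ≫ ρ) ρ) (0 : (0 : A) ⟶ R') ≫
          pullback.fst (j ≫ ρ) ρ = 0 := by
        rw [pullback.condition, comp_zero]
      have h₁ : (pullback.fst (pullback.fst (j ≫ ρ) ρ) (0 : (0 : A) ⟶ R') ≫
          pullback.snd (j ≫ ρ) ρ) ≫ ρ = 0 := by
        rw [Category.assoc, ← pullback.condition, reassoc_of% h₀, zero_comp]
      have h₂ : (kernel.lift ρ _ h₁ ≫ l) ≫ j = pullback.fst _ _ ≫ pullback.snd _ _ := by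
        rw [Category.assoc, hl, kernel.lift_ι]
      have hm {T : A} (t : T ⟶ R') (e₁ e₂) :
          pullback.map (pullback.fst (j ≫ ρ) (j ≫ ρ)) t (pullback.fst (j ≫ ρ) ρ) t k (𝟙 T) (𝟙 R')
            e₁ e₂ ≫ pullback.fst _ _ = pullback.fst _ _ ≫ k := pullback.lift_fst _ _ _
      have hm_assoc {T V : A} (t : T ⟶ R') (e₁ e₂) (z : pullback (j ≫ ρ) ρ ⟶ V) :
          pullback.map (pullback.fst (j ≫ ρ) (j ≫ ρ)) t (pullback.fst (j ≫ ρ) ρ) t k (𝟙 T) (𝟙 R')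
            e₁ e₂ ≫ pullback.fst _ _ ≫ z = pullback.fst _ _ ≫ k ≫ z := by
        rw [reassoc_of% (hm t e₁ e₂)]
      refine ⟨pullback.lift (pullback.lift 0 (kernel.lift ρ _ h₁ ≫ l) ?_)
        (pullback.snd _ _) ?_, ?_, ?_⟩
      · rw [zero_comp, ← Category.assoc, h₂, h₁]
      · rw [pullback.lift_fst, comp_zero]
      · apply pullback.hom_ext
        · apply pullback.hom_ext
          · rw [Category.assoc, Category.assoc, pullback.lift_fst_assoc, pullback.lift_fst,
              comp_zero, Category.id_comp, pullback.condition, comp_zero]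
          · rw [← cancel_mono j]
            simp only [Category.assoc]
            rw [pullback.lift_fst_assoc, pullback.lift_snd_assoc, Category.assoc, hl,
              kernel.lift_ι, hm_assoc, hk₂, Category.id_comp]
        · exact (isZero_zero A).eq_of_tgt _ _
      · apply pullback.hom_ext
        · apply pullback.hom_ext
          · rw [Category.assoc, Category.assoc, hm_assoc, pullback.lift_fst_assoc, hk₁,
              pullback.lift_fst, Category.id_comp, h₀]
          · rw [Category.assoc, Category.assoc, hm_assoc, pullback.lift_fst_assoc, hk₂,
              pullback.lift_snd_assoc, h₂, Category.id_comp]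
        · exact (isZero_zero A).eq_of_tgt _ _
  -- The second projection of `R' ×_Z R` is a pullback of the regular epimorphism `j ≫ ρ`. As `k` is
  -- invertible, `j` is a regular epimorphism as well as a monomorphism.
  have h : k ≫ pullback.snd (j ≫ ρ) ρ = pullback.snd _ _ ≫ j := hk₂
  have : IsRegularEpi (pullback.snd (j ≫ ρ) (j ≫ ρ) ≫ j) := by
    rw [← h]; exact isRegularEpi_comp _ _
  have := isRegularEpi_of_comp (pullback.snd (j ≫ ρ) (j ≫ ρ)) j
  exact isIso_of_mono_of_strongEpi j

/-- Let `q ≫ c = π ≫ q₀` with `q` a regular epimorphism. If the kernel of `q` contains the image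
of some `d : D ⟶ P` such that `d ≫ π` covers the kernel of `q₀`, then the kernel of `c` is
covered by the kernel of `π`. -/
theorem isExactAt_of_kernel_cover [HasZeroObject A] [Protomodular A] {D K P C Q Q₀ : A}
    (π : P ⟶ C) (q : P ⟶ Q) [IsRegularEpi q] (q₀ : C ⟶ Q₀) (c : Q ⟶ Q₀) (hc : q ≫ c = π ≫ q₀)
    (d : D ⟶ P) (hd : d ≫ q = 0) (hdπ : (d ≫ π) ≫ q₀ = 0)
    [IsRegularEpi (kernel.lift q₀ (d ≫ π) hdπ)]
    (κ : K ⟶ P) (hκ : κ ≫ π = 0) (s : kernel π ⟶ K) (hs : s ≫ κ = kernel.ι π) :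
    IsExactAt (MorphismProperty.regularEpi A) (κ ≫ q) c := by
  have w : (κ ≫ q) ≫ c = 0 := by rw [Category.assoc, hc, reassoc_of% hκ, zero_comp]
  refine ⟨w, ?_⟩
  -- It suffices to show that the image of `K` in `Ker(c)` is everything. This is tested on `R = P
  -- ×_Q Ker(c)`, which covers `Ker(c)` because `q` is a regular epimorphism.
  let F := Regular.strongEpiMonoFactorisation (kernel.lift c (κ ≫ q) w)
  have hF : F.e ≫ F.m = kernel.lift c (κ ≫ q) w := F.fac
  let ρ : pullback q (kernel.ι c) ⟶ kernel q₀ := kernel.lift q₀ (pullback.fst _ _ ≫ π) (by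
    rw [Category.assoc, ← hc, pullback.condition_assoc, kernel.condition, comp_zero])
  have hρ : ρ ≫ kernel.ι q₀ = pullback.fst _ _ ≫ π := kernel.lift_ι _ _ _
  -- The subobject of those elements of `R` whose class lies in the image of `K`. It contains `D`
  -- because `d` dies in `Q`, so it covers `Ker(q₀)`.
  let j := pullback.fst (pullback.snd q (kernel.ι c)) F.m
  let d' : D ⟶ pullback (pullback.snd q (kernel.ι c)) F.m :=
    pullback.lift (pullback.lift d 0 (by rw [hd, zero_comp])) 0
      (by rw [pullback.lift_snd, zero_comp])
  have hd' : d' ≫ j ≫ ρ = kernel.lift q₀ (d ≫ π) hdπ := by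
    rw [← cancel_mono (kernel.ι q₀), kernel.lift_ι, Category.assoc, Category.assoc, hρ,
      pullback.lift_fst_assoc, pullback.lift_fst_assoc]
  have : IsRegularEpi (d' ≫ j ≫ ρ) := by rw [hd']; infer_instance
  have := isRegularEpi_of_comp d' (j ≫ ρ)
  have h₀ : (kernel.ι ρ ≫ pullback.fst q (kernel.ι c)) ≫ π = 0 := by
    rw [Category.assoc, ← hρ, kernel.condition_assoc, zero_comp]
  -- An element of `Ker(ρ)` is killed by `π`, hence comes from `K` through `s`, and its class lies
  -- in the image.
  have : IsIso j := isIso_of_kernel_le j ρ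
    (pullback.lift (kernel.ι ρ) (kernel.lift π _ h₀ ≫ s ≫ F.e) (by
      rw [← cancel_mono (kernel.ι c)]
      simp only [Category.assoc]
      rw [← pullback.condition, reassoc_of% hF, kernel.lift_ι, reassoc_of% hs,
        kernel.lift_ι_assoc, Category.assoc])) (pullback.lift_fst _ _ _)
  have : IsRegularEpi (pullback.snd (pullback.snd q (kernel.ι c)) F.m ≫ F.m) := by
    rw [← pullback.condition]; exact isRegularEpi_comp j _
  have := isRegularEpi_of_comp (pullback.snd (pullback.snd q (kernel.ι c)) F.m) F.m
  have : IsRegularEpi F.e := inferInstanceAs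
    (IsRegularEpi (Regular.strongEpiMonoFactorisation (kernel.lift c (κ ≫ q) w)).e)
  rw [← hF]
  exact isRegularEpi_comp F.e F.m

/-- The pullback of `h` along an arrow out of a zero object is the kernel of `h`. -/
noncomputable def pullbackIsoKernel {O B D : A} (hO : IsZero O) (z : O ⟶ B) (h : D ⟶ B) :
    pullback z h ≅ kernel h where
  hom := kernel.lift h (pullback.snd z h) (by
    rw [← pullback.condition, hO.eq_of_src z 0, comp_zero])
  inv := pullback.lift 0 (kernel.ι h) (by rw [kernel.condition, zero_comp])
  hom_inv_id := by
    apply pullback.hom_ext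
    · exact hO.eq_of_tgt _ _
    · rw [Category.assoc, pullback.lift_snd, kernel.lift_ι, Category.id_comp]
  inv_hom_id := by
    rw [← cancel_mono (kernel.ι h), Category.assoc, kernel.lift_ι, pullback.lift_snd,
      Category.id_comp]

/-- The pullback of an arrow `h` along an arrow between zero objects is the domain of `h`. -/
noncomputable def pullbackIsoDom {O B D : A} (hO : IsZero O) (hB : IsZero B) (z : O ⟶ B)
    (h : D ⟶ B) : pullback z h ≅ D where
  hom := pullback.snd z h
  inv := pullback.lift 0 (𝟙 D) (hB.eq_of_tgt _ _)
  hom_inv_id := by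
    apply pullback.hom_ext
    · exact hO.eq_of_tgt _ _
    · rw [Category.assoc, pullback.lift_snd, Category.comp_id, Category.id_comp]
  inv_hom_id := pullback.lift_snd _ _ _

/-- If `b` has the same kernel as `q` and the comparison `k` from the domain of `h` to the kernel
of `b`, computed as a pullback, is a regular epimorphism, then `h` covers the kernel of `q`. -/
theorem isRegularEpi_kernel_lift_of_pullback {O B C D Q : A} (hO : IsZero O) (h : D ⟶ C)
    (q : C ⟶ Q) (hq : h ≫ q = 0) (b : C ⟶ B) (z : O ⟶ B) (t : B ⟶ Q) [Mono t] (hb : b ≫ t = q)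
    (k : pullback (𝟙 C) h ⟶ pullback b z) (hk' : IsRegularEpi k)
    (hk : k ≫ pullback.fst _ _ = pullback.fst _ _) :
    IsRegularEpi (kernel.lift q h hq) := by
  have hz : z = 0 := hO.eq_of_src _ _
  let r : pullback b z ⟶ kernel q := kernel.lift q (pullback.fst _ _) (by
    rw [← hb, pullback.condition_assoc, hz, zero_comp, comp_zero])
  -- As `t` is a monomorphism, `b` and `q` have the same kernel, so a section of `r` exists.
  have : IsSplitEpi r := ⟨⟨⟨pullback.lift (kernel.ι q) 0 (by
      rw [← cancel_mono t, Category.assoc, hb, kernel.condition, zero_comp, zero_comp]), by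
    rw [← cancel_mono (kernel.ι q), Category.assoc, kernel.lift_ι, pullback.lift_fst,
      Category.id_comp]⟩⟩⟩
  have := isRegularEpi_comp k r
  have e : k ≫ r = pullback.snd _ _ ≫ kernel.lift q h hq := by
    rw [← cancel_mono (kernel.ι q), Category.assoc, Category.assoc, kernel.lift_ι, kernel.lift_ι,
      hk, ← pullback.condition, Category.comp_id]
  rw [e] at this
  exact isRegularEpi_of_comp (pullback.snd (𝟙 C) h) _

end Pointed

end Snail

namespace Snail

namespace SeqFam

/-! ### Exactness of the six-term rows in the base category -/

section Rows

variable {A : Type u} [Category.{v} A] [HasZeroMorphisms A] [HasCokernels A] [Regular A]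

theorem Kmap_ι {X Y : SeqFam A} (f : X ⟶ Y) (n : ℤ) :
    Kmap f n ≫ kernel.ι (Y.h n) = kernel.ι (X.h n) ≫ f.top n :=
  kernel.lift_ι _ _ _

theorem π_Cmap {X Y : SeqFam A} (f : X ⟶ Y) (n : ℤ) :
    cokernel.π (X.h n) ≫ Cmap f n = f.bot n ≫ cokernel.π (Y.h n) :=
  cokernel.π_desc _ _ _

variable {X Y : SeqFam A} (f : X ⟶ Y) (n : ℤ)

theorem hkerι_top : (hkerι f).top n = 𝟙 (X.dom n) := rfl

theorem hkerι_bot : (hkerι f).bot n = pullback.fst (f.bot n) (Y.h n) := rfl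

/-- Exactness of the row at `Ker(h_n)`. -/
theorem isExactAt_ker_dom :
    IsExactAt (MorphismProperty.regularEpi A) (Kmap (hkerι f) n) (Kmap f n) := by
  have w : Kmap (hkerι f) n ≫ Kmap f n = 0 := by
    rw [← cancel_mono (kernel.ι _), Category.assoc, Kmap_ι, reassoc_of% (Kmap_ι (hkerι f) n),
      hkerι_top, Category.id_comp, zero_comp]
    exact (congrArg (kernel.ι (hP f n) ≫ ·) (hP_snd f n).symm).trans
      (kernel.condition_assoc _ _)|>.trans zero_comp
  refine isExactAt_of_cover w (kernel.lift (hP f n) (kernel.ι (Kmap f n) ≫ kernel.ι (X.h n)) ?_)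
    (𝟙 (kernel (Kmap f n))) ?_
  · apply pullback.hom_ext
    · rw [Category.assoc, Category.assoc, hP_fst, kernel.condition, comp_zero, zero_comp]
    · rw [Category.assoc, Category.assoc, hP_snd, ← Kmap_ι, kernel.condition_assoc, zero_comp,
        zero_comp]
  · rw [← cancel_mono (kernel.ι _), Category.assoc, Kmap_ι (hkerι f) n, hkerι_top,
      Category.comp_id, Category.id_comp]
    exact kernel.lift_ι _ _ _

/-- The arrow `⟨0, k'_n⟩ : Ker(h'_n) ⟶ P_n`. -/
noncomputable def kerIncl : kernel (Y.h n) ⟶ pullback (f.bot n) (Y.h n) :=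
  pullback.lift 0 (kernel.ι (Y.h n)) (by simp)

theorem kerIncl_fst : kerIncl f n ≫ pullback.fst _ _ = 0 := pullback.lift_fst _ _ _

theorem kerIncl_snd : kerIncl f n ≫ pullback.snd _ _ = kernel.ι (Y.h n) := pullback.lift_snd _ _ _

theorem rowδ_eq : rowδ f n = kerIncl f n ≫ cokernel.π (hP f n) := rfl

/-- Exactness of the row at `Ker(h'_n)`. -/
theorem isExactAt_ker_cod
    [IsRegularEpi (kernel.lift (cokernel.π (hP f n)) (hP f n) (cokernel.condition _))] :
    IsExactAt (MorphismProperty.regularEpi A) (Kmap f n) (rowδ f n) := by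
  let e := kernel.lift (cokernel.π (hP f n)) (hP f n) (cokernel.condition _)
  have he : e ≫ kernel.ι _ = hP f n := kernel.lift_ι _ _ _
  have : IsRegularEpi e := by assumption
  have w : Kmap f n ≫ rowδ f n = 0 := by
    have : Kmap f n ≫ kerIncl f n = kernel.ι (X.h n) ≫ hP f n := by
      apply pullback.hom_ext
      · rw [Category.assoc, Category.assoc, hP_fst, kerIncl_fst, kernel.condition, comp_zero]
      · rw [Category.assoc, Category.assoc, hP_snd, kerIncl_snd, Kmap_ι]
    rw [rowδ_eq, reassoc_of% this, cokernel.condition, comp_zero]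
  -- `t` views an element `y` of the kernel of `rowδ` as `⟨0, y⟩` in the kernel of `q^P_n`. Pulling
  -- back along `e` gives a cover on which `⟨0, y⟩ = h^P_n(x)`; this is `key`.
  have hw : (kernel.ι (rowδ f n) ≫ kerIncl f n) ≫ cokernel.π (hP f n) = 0 := by
    rw [Category.assoc, ← rowδ_eq, kernel.condition]
  let t := kernel.lift _ _ hw
  have ht : t ≫ kernel.ι _ = kernel.ι (rowδ f n) ≫ kerIncl f n := kernel.lift_ι _ _ _
  have key : pullback.snd t e ≫ hP f n =
      pullback.fst t e ≫ kernel.ι (rowδ f n) ≫ kerIncl f n :=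
    ((congrArg (pullback.snd t e ≫ ·) he.symm).trans (pullback.condition_assoc _).symm).trans
      (congrArg (pullback.fst t e ≫ ·) ht)
  refine isExactAt_of_cover w (kernel.lift (X.h n) (pullback.snd t e) ?_) (pullback.fst t e) ?_
  · rw [← hP_fst f n, reassoc_of% key, kerIncl_fst, comp_zero, comp_zero]
  · rw [← cancel_mono (kernel.ι _), Category.assoc, Kmap_ι, kernel.lift_ι_assoc, ← hP_snd f n,
      reassoc_of% key, kerIncl_snd, Category.assoc]

/-- Exactness of the row at `Cok(h^P_n)`. -/
theorem isExactAt_cok_hker [HasZeroObject A] [Protomodular A]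
    [IsRegularEpi (kernel.lift (cokernel.π (X.h n)) (X.h n) (cokernel.condition _))] :
    IsExactAt (MorphismProperty.regularEpi A) (rowδ f n) (Cmap (hkerι f) n) := by
  have hd : (hP f n ≫ pullback.fst _ _) ≫ cokernel.π (X.h n) = 0 := by
    rw [hP_fst, cokernel.condition]
  have : IsRegularEpi (kernel.lift (cokernel.π (X.h n)) (hP f n ≫ pullback.fst _ _) hd) := by
    simp only [hP_fst]
    infer_instance
  -- Here `d` is `h^P_n`: its first component is `h_n`, which covers the kernel of `q₀` by the
  -- assumption on `h`.
  refine isExactAt_of_kernel_cover (pullback.fst (f.bot n) (Y.h n)) (cokernel.π (hP f n))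
    (cokernel.π (X.h n)) (Cmap (hkerι f) n) (π_Cmap (hkerι f) n) (hP f n)
    (cokernel.condition _) hd (kerIncl f n) (kerIncl_fst f n)
    (kernel.lift (Y.h n) (kernel.ι (pullback.fst _ _) ≫ pullback.snd (f.bot n) (Y.h n)) ?_) ?_
  · rw [Category.assoc, ← pullback.condition, kernel.condition_assoc, zero_comp]
  · apply pullback.hom_ext
    · rw [Category.assoc, kerIncl_fst, comp_zero, kernel.condition]
    · rw [Category.assoc, kerIncl_snd, kernel.lift_ι]

/-- Exactness of the row at `Cok(h_n)`. -/
theorem isExactAt_cok_dom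
    [IsRegularEpi (kernel.lift (cokernel.π (Y.h n)) (Y.h n) (cokernel.condition _))] :
    IsExactAt (MorphismProperty.regularEpi A) (Cmap (hkerι f) n) (Cmap f n) := by
  let e := kernel.lift (cokernel.π (Y.h n)) (Y.h n) (cokernel.condition _)
  have he : e ≫ kernel.ι _ = Y.h n := kernel.lift_ι _ _ _
  have : IsRegularEpi e := by assumption
  have w : Cmap (hkerι f) n ≫ Cmap f n = 0 := by
    rw [← cancel_epi (cokernel.π _), reassoc_of% (π_Cmap (hkerι f) n), π_Cmap, hkerι_bot,
      pullback.condition_assoc, cokernel.condition, comp_zero, comp_zero]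
  -- `s` is a local representative `b` in `Cod(h_n)` of an element of `Ker(C(f)_n)`. Over the
  -- further cover given by `e`, its image under `f` lifts to `Dom(h'_n)`, and `p` is the resulting
  -- element of `P_n`.
  let s := pullback.snd (kernel.ι (Cmap f n)) (cokernel.π (X.h n))
  have hs : (s ≫ f.bot n) ≫ cokernel.π (Y.h n) = 0 := by
    rw [Category.assoc, ← π_Cmap, ← pullback.condition_assoc, kernel.condition, comp_zero]
  let t := kernel.lift _ _ hs
  have ht : t ≫ kernel.ι _ = s ≫ f.bot n := kernel.lift_ι _ _ _
  have := isRegularEpi_comp (pullback.fst t e)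
    (pullback.fst (kernel.ι (Cmap f n)) (cokernel.π (X.h n)))
  let p : pullback t e ⟶ pullback (f.bot n) (Y.h n) :=
    pullback.lift (pullback.fst t e ≫ s) (pullback.snd t e) 
      ((Category.assoc _ _ _).trans <| (congrArg (pullback.fst t e ≫ ·) ht.symm).trans <|
        (pullback.condition_assoc _).trans (congrArg (pullback.snd t e ≫ ·) he))
  refine isExactAt_of_cover w (p ≫ cokernel.π (hP f n)) (pullback.fst t e ≫ pullback.fst _ _) ?_
  rw [Category.assoc, Category.assoc, pullback.condition]
  refine (congrArg (p ≫ ·) (π_Cmap (hkerι f) n)).trans ?_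
  rw [hkerι_bot, pullback.lift_fst_assoc, Category.assoc]

end Rows

end SeqFam

end Snail

namespace Snail

namespace SeqFam

/-! ### From the rows to the six-term sequence of families -/

section SixTerm

variable {A : Type u} [Category.{v} A] [HasZeroObject A] [HasZeroMorphisms A] [HasCokernels A]
  [Regular A]

open ZeroObject

/-- Exactness in the base category gives exactness for families of the form `0 ⟶ A_n`. -/
theorem exists_isExact_of_isZero_dom {X Y Z : SeqFam A} (a : X ⟶ Y) (b : Y ⟶ Z)
    (hX : ∀ n, IsZero (X.dom n)) (hY : ∀ n, IsZero (Y.dom n)) (hZ : ∀ n, IsZero (Z.dom n))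
    (H : ∀ n, IsExactAt (MorphismProperty.regularEpi A) (a.bot n) (b.bot n)) :
    ∃ φ, (setting A).IsExact (levelwise (MorphismProperty.regularEpi A)) a b φ := by
  refine ⟨⟨fun n => 0, fun n => (hX n).eq_of_src _ _, fun n => ?_⟩, fun n => ⟨?_, ?_⟩⟩
  · rw [zero_comp, comp_bot, (H n).1]
  · have : IsIso (a.top n) := (hX n).isIso (hY n) _
    exact inferInstanceAs (IsRegularEpi (a.top n))
  · obtain ⟨w, hw⟩ := H n
    have hw : IsRegularEpi (kernel.lift (b.bot n) (a.bot n) w) := hw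
    have hz : Z.h n = 0 := (hZ n).eq_of_src _ _
    -- Since `Z.dom n` is zero, the pullback `P_n` of the homotopy kernel of `b` is the kernel of
    -- `b.bot n`.
    let t : kernel (b.bot n) ⟶ pullback (b.bot n) (Z.h n) :=
      pullback.lift (kernel.ι _) 0 (by rw [kernel.condition, zero_comp])
    have : IsSplitEpi t := ⟨⟨⟨kernel.lift _ (pullback.fst _ _)
        (by rw [pullback.condition, hz, comp_zero]), by
      apply pullback.hom_ext
      · rw [Category.assoc, pullback.lift_fst, kernel.lift_ι, Category.id_comp]
      · exact (hZ n).eq_of_tgt _ _⟩⟩⟩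
    have := isRegularEpi_comp (kernel.lift (b.bot n) (a.bot n) w) t
    have e : kernel.lift (b.bot n) (a.bot n) w ≫ t = pullback.lift (a.bot n) 0
        (by rw [w, zero_comp]) := by
      apply pullback.hom_ext
      · rw [Category.assoc, pullback.lift_fst, kernel.lift_ι, pullback.lift_fst]
      · rw [Category.assoc, pullback.lift_snd, comp_zero, pullback.lift_snd]
    rw [e] at this
    exact this

theorem N₀_dom (Y : SeqFam A) (n : ℤ) : IsZero (((setting A).N₀ Y).dom n) := isZero_zero A

theorem pi0_dom (Y : SeqFam A) (n : ℤ) : IsZero (((setting A).pi0 Y).dom n) := isZero_zero A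

/-- The family `N(0_Y)` is `0 ⟶ Ker(h_n)`. -/
noncomputable def N₀Cod (Y : SeqFam A) (n : ℤ) : ((setting A).N₀ Y).cod n ≅ kernel (Y.h n) :=
  pullbackIsoKernel (zeroFam_cod n) (Hom.bot ((setting A).isZero.to_ Y) n) (Y.h n)

theorem N₀Cod_ι (Y : SeqFam A) (n : ℤ) : (N₀Cod Y n).hom ≫ kernel.ι (Y.h n) =
    Null.diag ((setting A).ν ((setting A).isZero.to_ Y)) n :=
  kernel.lift_ι _ _ _

/-- The family `π₀(Y)` is `0 ⟶ Cok(h_n)`. -/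
noncomputable def pi0Cod (Y : SeqFam A) (n : ℤ) :
    ((setting A).pi0 Y).cod n ≅ cokernel (Y.h n) :=
  pullbackIsoDom (zeroFam_cod n) (isZero_zero A) (Hom.bot ((setting A).c₀ Y) n)
    (((setting A).C₀ Y).h n)

theorem η_pi0Cod (Y : SeqFam A) (n : ℤ) :
    ((setting A).η Y).bot n ≫ (pi0Cod Y n).hom = cokernel.π (Y.h n) :=
  pullback.lift_snd _ _ _

/-- The canonical factorization `N(id_Y) ⟶ N(η_Y)` being levelwise a regular epimorphism, each
`h_n` covers the kernel of its cokernel. -/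
theorem IsProper.isRegularEpi_lift {Y : SeqFam A}
    (H : (setting A).IsProper (levelwise (MorphismProperty.regularEpi A)) Y) (n : ℤ) :
    IsRegularEpi (kernel.lift (cokernel.π (Y.h n)) (Y.h n) (cokernel.condition _)) := by
  exact isRegularEpi_kernel_lift_of_pullback (isZero_zero A) (Y.h n) (cokernel.π (Y.h n))
    (cokernel.condition _) (((setting A).η Y).bot n) (((setting A).pi0 Y).h n) (pi0Cod Y n).hom
    (η_pi0Cod Y n) (((setting A).properArrow Y).bot n) (H n).2
    (pullback.lift_fst _ _ _)

theorem mapN₀_N₀Cod {X Y : SeqFam A} (g : X ⟶ Y) (n : ℤ) :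
    ((setting A).mapN₀ g).bot n ≫ (N₀Cod Y n).hom = (N₀Cod X n).hom ≫ Kmap g n := by
  rw [← cancel_mono (kernel.ι _), Category.assoc, Category.assoc, N₀Cod_ι, Kmap_ι,
    reassoc_of% (N₀Cod_ι X n)]
  refine (pullback.lift_snd _ _ _).trans ?_
  rw [post_diag]

theorem mapPi0_pi0Cod {X Y : SeqFam A} (g : X ⟶ Y) (n : ℤ) :
    ((setting A).mapPi0 g).bot n ≫ (pi0Cod Y n).hom = (pi0Cod X n).hom ≫ Cmap g n := by
  refine (pullback.lift_snd _ _ _).trans ?_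
  rw [post_diag]
  refine congrArg (_ ≫ ·) ((cancel_epi (cokernel.π (X.h n))).1 ?_)
  exact ((cokernel.π_desc _ _ _).trans (pre_diag _ _ _ n)).trans (π_Cmap g n).symm

/-- The components of `Δ` on `P_n` are read off its two defining conditions: composing with `n_g`
gives zero, and composing with `ν_g` gives `ν_{0_Y}`, which is the inclusion of the kernel. -/
theorem Δ_N₀Cod {X Y : SeqFam A} (g : X ⟶ Y) (n : ℤ) :
    ((setting A).Δ g).bot n = (N₀Cod Y n).hom ≫ kerIncl g n := by
  apply pullback.hom_ext
  · rw [Category.assoc, kerIncl_fst, comp_zero]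
    refine (pullback.lift_fst _ _ _).trans ?_
    exact (congrArg (_ ≫ ·) ((zeroFam_cod n).eq_of_src _ 0)).trans comp_zero
  · rw [Category.assoc, kerIncl_snd, N₀Cod_ι]
    refine (pullback.lift_snd _ _ _).trans ?_
    rw [pre_diag, id_bot, Category.id_comp]

theorem δ_pi0Cod {X Y : SeqFam A} (g : X ⟶ Y) (n : ℤ) :
    ((setting A).δ g).bot n ≫ (pi0Cod (hkerObj g) n).hom = (N₀Cod Y n).hom ≫ rowδ g n := by
  rw [rowδ_eq, ← Category.assoc, ← Δ_N₀Cod]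
  refine (Category.assoc _ _ _).trans (congrArg (_ ≫ ·) ?_)
  exact η_pi0Cod _ n

/-- All six families have zero domains, so their exactness is that of their codomains, and the
isomorphisms `N₀Cod` and `pi0Cod` identify these with the rows. -/
theorem isSnailExact_of_isRowExact {X Y : SeqFam A} (f : X ⟶ Y)
    (H : ∀ n, IsRowExact (MorphismProperty.regularEpi A) f n) :
    (setting A).IsSnailExact (levelwise (MorphismProperty.regularEpi A)) f := by
  refine ⟨?_, ?_, ?_, ?_⟩
  · exact exists_isExact_of_isZero_dom _ _ (N₀_dom _) (N₀_dom _) (N₀_dom _) fun n =>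
      (H n).1.of_iso (N₀Cod _ n) (N₀Cod _ n) (N₀Cod _ n) (mapN₀_N₀Cod _ n) (mapN₀_N₀Cod _ n)
  · exact exists_isExact_of_isZero_dom _ _ (N₀_dom _) (N₀_dom _) (pi0_dom _) fun n =>
      (H n).2.1.of_iso (N₀Cod _ n) (N₀Cod _ n) (pi0Cod _ n) (mapN₀_N₀Cod _ n) (δ_pi0Cod _ n)
  · exact exists_isExact_of_isZero_dom _ _ (N₀_dom _) (pi0_dom _) (pi0_dom _) fun n =>
      (H n).2.2.1.of_iso (N₀Cod _ n) (pi0Cod _ n) (pi0Cod _ n) (δ_pi0Cod _ n) (mapPi0_pi0Cod _ n)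
  · exact exists_isExact_of_isZero_dom _ _ (pi0_dom _) (pi0_dom _) (pi0_dom _) fun n =>
      (H n).2.2.2.of_iso (pi0Cod _ n) (pi0Cod _ n) (pi0Cod _ n) (mapPi0_pi0Cod _ n)
        (mapPi0_pi0Cod _ n)

theorem isRowExact_of_isProper [Protomodular A] {X Y : SeqFam A} (f : X ⟶ Y)
    (hN : (setting A).IsProper (levelwise (MorphismProperty.regularEpi A)) ((setting A).N f))
    (hX : (setting A).IsProper (levelwise (MorphismProperty.regularEpi A)) X)
    (hY : (setting A).IsProper (levelwise (MorphismProperty.regularEpi A)) Y) (n : ℤ) :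
    IsRowExact (MorphismProperty.regularEpi A) f n := by
  have : IsRegularEpi (kernel.lift (cokernel.π (hP f n)) (hP f n) (cokernel.condition _)) :=
    IsProper.isRegularEpi_lift hN n
  have := IsProper.isRegularEpi_lift hX n
  have := IsProper.isRegularEpi_lift hY n
  exact ⟨isExactAt_ker_dom f n, isExactAt_ker_cod f n, isExactAt_cok_hker f n,
    isExactAt_cok_dom f n⟩

end SixTerm

/-! ### Splicing the rows into the long sequence -/

section Long

variable {A : Type u} [Category.{v} A] [HasZeroMorphisms A] [HasCokernels A] [Regular A]

theorem isLongExact_of_isRowExact {X Y : SeqFam A} (f : X ⟶ Y)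
    (H : ∀ n, IsRowExact (MorphismProperty.regularEpi A) f n) (hX : X.IsIsoSeq)
    (hY : Y.IsIsoSeq) : IsLongExact (MorphismProperty.regularEpi A) f := by
  intro n
  have := hX n
  have := hY n
  refine ⟨?_, (H n).2.2.1, ?_⟩
  -- At `Ker(h'_n)`: `link` is `K(f)_n` preceded by the isomorphism `i_n`.
  · refine (H n).2.1.of_iso (asIso (X.i n)) (Iso.refl _) (Iso.refl _) ?_ ?_
    · rw [Iso.refl_hom, Category.comp_id]
      exact Cmap_i f n
    · rw [Iso.refl_hom, Iso.refl_hom, Category.comp_id, Category.id_comp]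
  -- At `Cok(h_{n+1})`, the row of index `n + 1` is needed: `link` is `C(f)_{n+1}` followed by the
  -- isomorphism `i'_n`, which does not change the kernel.
  · refine (H (n + 1)).2.2.2.of_iso (Iso.refl _) (Iso.refl _) (asIso (Y.i n)).symm ?_ ?_
    · rw [Iso.refl_hom, Iso.refl_hom, Category.comp_id, Category.id_comp]
    · rw [Iso.refl_hom, Category.id_comp]
      exact (asIso (Y.i n)).comp_inv_eq.mpr rfl

end Long

end SeqFam

end Snail
theorem mainTheorem2 {A : Type u} [Category.{v} A] [HasZeroObject A] [HasZeroMorphisms A]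
    [HasCokernels A] [Regular A] [Snail.Protomodular A] {h h' : Snail.SeqFam A} (f : h ⟶ h')
    (hN : (Snail.SeqFam.setting A).IsProper
      (Snail.SeqFam.levelwise (MorphismProperty.regularEpi A)) ((Snail.SeqFam.setting A).N f))
    (hh : (Snail.SeqFam.setting A).IsProper
      (Snail.SeqFam.levelwise (MorphismProperty.regularEpi A)) h)
    (hh' : (Snail.SeqFam.setting A).IsProper
      (Snail.SeqFam.levelwise (MorphismProperty.regularEpi A)) h') :
    ((Snail.SeqFam.setting A).IsSnailExact
        (Snail.SeqFam.levelwise (MorphismProperty.regularEpi A)) f ∧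
      ∀ n : ℤ, Snail.SeqFam.IsRowExact (MorphismProperty.regularEpi A) f n) ∧
    (h.IsIsoSeq → h'.IsIsoSeq →
      Snail.SeqFam.IsLongExact (MorphismProperty.regularEpi A) f) := by
  have hrow := Snail.SeqFam.isRowExact_of_isProper f hN hh hh'
  exact ⟨⟨Snail.SeqFam.isSnailExact_of_isRowExact f hrow, hrow⟩,
    Snail.SeqFam.isLongExact_of_isRowExact f hrow⟩
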